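/- Let $n\ge 1$ be an integer, let $P\ge 2$ be real, and consider the Min Knapsack instance $$\min \sum_{i=1}^n x_i \quad\text{s.t.}\quad \sum_{i=1}^n x_i\ge \tfrac1P,\qquad x\in\{0,1\}^n .$$ Let $\mathcal G=\{\pm(x_i^2-x_i): 1\le i\le n\}\cup\{\sum_i x_i-\tfrac1P\}$. For $d\in\mathbb N$, a polynomial $p\in\mathbb R[x_1,\dots,x_n]$ has a degree $d$ SoS certificate over $\mathcal G$ if $p=s_0+\sum_{g\in\mathcal G}s_g\,g$, where every $s_g$ is a finite sum of squares of polynomials of degree at most $d$ and $s_0$ is a finite sum of squares of polynomials of degree at most $d+1$. The degree $d$ SoS program $\max\{\lambda\in\mathbb R : \sum_i x_i-\lambda \text{ has a degree } d \text{ SoS certificate over } \mathcal G\}$ is called exact if its optimum is attained and equals the optimum of the instance. The SoS rank $r(n,P)$ is the smallest $d\in\mathbb N$ for which the degree $d$ SoS program is exact. Then the SoS rank exists and is at most $O(\sqrt n\,\log P)$, and this is tight for constant $P$: there are absolute constants $c,C>0$ such that for all integers $n\ge 1$ and all real $P\ge 2$, $$c\,\sqrt n\;\le\; r(n,P)\;\le\;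 C\,\sqrt n\,\log P .$$ -/

import Mathlib

/-- `Σ_{n,k}`: finite sums of squares of real `n`-variate polynomials of degree at most `k`
(so the sums themselves have degree at most `2 * k`). -/
def sumsOfSquares (n k : ℕ) : Set (MvPolynomial (Fin n) ℝ) :=
  {s | ∃ (N : ℕ) (q : Fin N → MvPolynomial (Fin n) ℝ),
    (∀ i, (q i).totalDegree ≤ k) ∧ s = ∑ i, q i ^ 2}

open Classical in
/-- The Boolean axioms `± (x_i ^ 2 - x_i)`, `i = 1, …, n`. -/
noncomputable def booleanAxioms (n : ℕ) : Finset (MvPolynomial (Fin n) ℝ) :=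
  Finset.univ.image (fun i : Fin n => MvPolynomial.X i ^ 2 - MvPolynomial.X i) ∪
    Finset.univ.image (fun i : Fin n => -(MvPolynomial.X i ^ 2 - MvPolynomial.X i))

/-- The semialgebraic set `{x ∈ ℝⁿ | g x ≥ 0 for all g ∈ G}`. -/
def semialgebraicSet {n : ℕ} (G : Finset (MvPolynomial (Fin n) ℝ)) : Set (Fin n → ℝ) :=
  {x | ∀ g ∈ G, 0 ≤ MvPolynomial.eval x g}

/-- The maximal degree of a polynomial in `G`. -/
def maxDegree {n : ℕ} (G : Finset (MvPolynomial (Fin n) ℝ)) : ℕ :=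
  G.sup MvPolynomial.totalDegree

/-- The polynomials with a degree `d` SoS certificate of nonnegativity over `G`:
`s₀ + ∑_{g ∈ G} s_g * g`, where each `s_g` is a sum of squares of polynomials of degree at
most `d` (so `deg s_g ≤ 2 * d`), and `s₀` is a sum of squares with
`deg s₀ ≤ 2 * ⌈(2 * d + deg G) / 2⌉`. -/
def sosCertified {n : ℕ} (G : Finset (MvPolynomial (Fin n) ℝ)) (d : ℕ) :
    Set (MvPolynomial (Fin n) ℝ) :=
  {p | ∃ s₀ ∈ sumsOfSquares n ((2 * d + maxDegree G) ⌈/⌉ 2),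
    ∃ s : MvPolynomial (Fin n) ℝ → MvPolynomial (Fin n) ℝ,
      (∀ g ∈ G, s g ∈ sumsOfSquares n d) ∧ p = s₀ + ∑ g ∈ G, s g * g}

/-- The degree `d` SoS program `max {l | f - l has a degree d SoS certificate over G}` is exact
for the problem `min {f x | x ∈ semialgebraicSet G}`: both optima exist and they are equal. -/
def SoSExact {n : ℕ} (G : Finset (MvPolynomial (Fin n) ℝ)) (f : MvPolynomial (Fin n) ℝ)
    (d : ℕ) : Prop :=
  ∃ v : ℝ, IsLeast ((fun x => MvPolynomial.eval x f) '' semialgebraicSet G) v ∧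
    IsGreatest {l : ℝ | f - MvPolynomial.C l ∈ sosCertified G d} v

/-- `r` is the SoS rank of `min {f x | x ∈ semialgebraicSet G}`: the smallest degree for which
the SoS program is exact. -/
def IsSoSRank {n : ℕ} (G : Finset (MvPolynomial (Fin n) ℝ)) (f : MvPolynomial (Fin n) ℝ)
    (r : ℕ) : Prop :=
  IsLeast {d : ℕ | SoSExact G f d} r

/-- The objective `x_1 + … + x_n` of the Min Knapsack instance. -/
noncomputable def mkObjective (n : ℕ) : MvPolynomial (Fin n) ℝ :=
  ∑ i, MvPolynomial.X i

open Classical in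
/-- The constraints of the Min Knapsack instance: the Boolean axioms, together with
`x_1 + … + x_n ≥ 1 / P`. -/
noncomputable def mkConstraints (n : ℕ) (P : ℝ) : Finset (MvPolynomial (Fin n) ℝ) :=
  booleanAxioms n ∪ {mkObjective n - MvPolynomial.C (1 / P)}

/-! The instance has optimum `1`, so exactness in degree `d` means that `∑ xᵢ - 1` has a degree `d`
certificate. Modulo the Boolean axioms only `s₀` and the multiplier of `∑ xᵢ - 1/P` matter.

Upper bound. Take the multiplier `P q(∑ xᵢ)²` with `q` univariate, `q(0) = 1` and `q(1) = 0`. The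
remainder `R(t) = t - 1 - q(t)² (P t - 1)` then vanishes at `0` and `1`, so `R = t (t - 1) W`. On
the cube `t (t - 1)` is a sum of squares, and so is `W(∑ xᵢ)` if `W ≥ 0` on `[0, n]`; this is
`soSExact_of_multiplier`. Positivity of `W` requires `q² ≤ 1` on `[0, 1]` and `q² (P t - 1) ≤ t - 1`
on `[1, n]`. A shifted Chebyshev polynomial of degree `O(√n)` gains a constant factor between `0`
and `[1, n]`, and its `O(log P)`-th power absorbs `P` (`exists_multiplier_polynomial`).

Lower bound. Averaging the multiplier over the slices of the cube gives a univariate `h` of degree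
at most `2 d` with `h(0) ≥ 2`, `h(1) = 0` and `0 ≤ h(k) ≤ 1` for `1 ≤ k ≤ n`. If `16 d² ≤ n`,
Lagrange interpolation at `1` and the points `4 i²` forces `h(0) ≤ 1`
(`eval_zero_le_one_of_bounded`), a contradiction. -/

/-! ### Sums of squares and certificates -/

theorem mem_sumsOfSquares_of_fintype {n k : ℕ} {ι : Type*} [Fintype ι]
    (q : ι → MvPolynomial (Fin n) ℝ) (hq : ∀ i, (q i).totalDegree ≤ k) :
    ∑ i, q i ^ 2 ∈ sumsOfSquares n k :=
  ⟨Fintype.card ι, fun i => q ((Fintype.equivFin ι).symm i), fun _ => hq _,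
    ((Fintype.equivFin ι).symm.sum_comp fun i => q i ^ 2).symm⟩

theorem sq_mem_sumsOfSquares {n k : ℕ} {q : MvPolynomial (Fin n) ℝ} (hq : q.totalDegree ≤ k) :
    q ^ 2 ∈ sumsOfSquares n k := by
  simpa using mem_sumsOfSquares_of_fintype (fun _ : Unit => q) fun _ => hq

theorem sumsOfSquares_mono {n k l : ℕ} (h : k ≤ l) : sumsOfSquares n k ⊆ sumsOfSquares n l := by
  rintro _ ⟨N, q, hq, rfl⟩
  exact ⟨N, q, fun i => (hq i).trans h, rfl⟩

theorem add_mem_sumsOfSquares {n k : ℕ} {a b : MvPolynomial (Fin n) ℝ}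
    (ha : a ∈ sumsOfSquares n k) (hb : b ∈ sumsOfSquares n k) : a + b ∈ sumsOfSquares n k := by
  obtain ⟨N, q, hq, rfl⟩ := ha
  obtain ⟨M, r, hr, rfl⟩ := hb
  have := mem_sumsOfSquares_of_fintype (Sum.elim q r) (k := k) (by rintro (i | i) <;> simp [hq, hr])
  simpa [Fintype.sum_sum_type] using this

theorem zero_mem_sumsOfSquares {n k : ℕ} : (0 : MvPolynomial (Fin n) ℝ) ∈ sumsOfSquares n k :=
  ⟨0, fun _ => 0, fun i => i.elim0, by simp⟩

theorem mul_mem_sumsOfSquares {n k l : ℕ} {a b : MvPolynomial (Fin n) ℝ}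
    (ha : a ∈ sumsOfSquares n k) (hb : b ∈ sumsOfSquares n l) :
    a * b ∈ sumsOfSquares n (k + l) := by
  obtain ⟨N, q, hq, rfl⟩ := ha
  obtain ⟨M, r, hr, rfl⟩ := hb
  have := mem_sumsOfSquares_of_fintype (fun p : Fin N × Fin M => q p.1 * r p.2) (k := k + l)
    fun p => (MvPolynomial.totalDegree_mul _ _).trans (add_le_add (hq _) (hr _))
  simpa [Fintype.sum_prod_type, Finset.sum_mul_sum, mul_pow] using this

theorem C_mem_sumsOfSquares {n k : ℕ} {c : ℝ} (hc : 0 ≤ c) :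
    (MvPolynomial.C c : MvPolynomial (Fin n) ℝ) ∈ sumsOfSquares n k := by
  have := sq_mem_sumsOfSquares (n := n) (k := k) (q := MvPolynomial.C (Real.sqrt c)) (by simp)
  rwa [← map_pow, Real.sq_sqrt hc] at this

theorem eval_nonneg_of_mem_sumsOfSquares {n k : ℕ} {s : MvPolynomial (Fin n) ℝ}
    (hs : s ∈ sumsOfSquares n k) (x : Fin n → ℝ) : 0 ≤ MvPolynomial.eval x s := by
  obtain ⟨N, q, -, rfl⟩ := hs
  simp only [map_sum, map_pow]
  positivity

theorem totalDegree_le_of_mem_sumsOfSquares {n k : ℕ} {s : MvPolynomial (Fin n) ℝ}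
    (hs : s ∈ sumsOfSquares n k) : s.totalDegree ≤ 2 * k := by
  obtain ⟨N, q, hq, rfl⟩ := hs
  refine MvPolynomial.totalDegree_finsetSum_le fun i _ => ?_
  exact (MvPolynomial.totalDegree_pow _ _).trans (Nat.mul_le_mul_left _ (hq i))

/-- A monomial of degree at most `k + l` splits into factors of degrees at most `k` and `l`. -/
theorem exists_add_eq_of_degree_le {n k l : ℕ} (m : Fin n →₀ ℕ) (hm : m.degree ≤ k + l) :
    ∃ a b : Fin n →₀ ℕ, a + b = m ∧ a.degree ≤ k ∧ b.degree ≤ l := by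
  induction k generalizing m with
  | zero => exact ⟨0, m, by simp, by simp, by simpa using hm⟩
  | succ k ih =>
    by_cases h0 : m = 0
    · exact ⟨0, 0, by simp [h0], by simp, by simp⟩
    obtain ⟨i, hi⟩ := Finsupp.ne_iff.1 h0
    have hle : Finsupp.single i 1 ≤ m := by
      simpa [Finsupp.single_le_iff] using Nat.one_le_iff_ne_zero.2 hi
    obtain ⟨m', rfl⟩ := exists_add_of_le hle
    obtain ⟨a, b, rfl, ha, hb⟩ := ih m' (by simp at hm; omega)
    exact ⟨Finsupp.single i 1 + a, b, by rw [add_assoc], by simp; omega, hb⟩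

/-- Polarization: each monomial is a product of two of degree at most `k`, and `4ab = (a + b)² - (a
- b)²`. With both signs of the Boolean axioms available, this makes their multipliers effectively
arbitrary. -/
theorem exists_sub_mem_sumsOfSquares {n k : ℕ} (p : MvPolynomial (Fin n) ℝ)
    (hp : p.totalDegree ≤ 2 * k) :
    ∃ a ∈ sumsOfSquares n k, ∃ b ∈ sumsOfSquares n k, p = a - b := by
  have key : ∀ s : Finset (Fin n →₀ ℕ), (∀ m ∈ s, m.degree ≤ 2 * k) →
      ∃ a ∈ sumsOfSquares n k, ∃ b ∈ sumsOfSquares n k,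
        ∑ m ∈ s, MvPolynomial.monomial m (p.coeff m) = a - b := by
    intro s
    induction s using Finset.induction_on with
    | empty => exact fun _ => ⟨0, zero_mem_sumsOfSquares, 0, zero_mem_sumsOfSquares, by simp⟩
    | insert m s hm ih =>
      intro hs
      obtain ⟨a, ha, b, hb, hab⟩ := ih fun m hm => hs m (Finset.mem_insert_of_mem hm)
      obtain ⟨u, v, huv, hu, hv⟩ := exists_add_eq_of_degree_le (k := k) (l := k) m
        (by simpa [two_mul] using hs m (Finset.mem_insert_self _ _))
      set c := p.coeff m with hc
      have hu' : ∀ c : ℝ, (MvPolynomial.monomial u c).totalDegree ≤ k := fun c =>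
        (MvPolynomial.totalDegree_monomial_le _ _).trans hu
      have hv' : ∀ c : ℝ, (MvPolynomial.monomial v c).totalDegree ≤ k := fun c =>
        (MvPolynomial.totalDegree_monomial_le _ _).trans hv
      refine ⟨_, add_mem_sumsOfSquares (sq_mem_sumsOfSquares
          (q := MvPolynomial.monomial u (c / 2) + MvPolynomial.monomial v (1 / 2)) ?_) ha,
        _, add_mem_sumsOfSquares (sq_mem_sumsOfSquares
          (q := MvPolynomial.monomial u (c / 2) - MvPolynomial.monomial v (1 / 2)) ?_) hb, ?_⟩
      · exact (MvPolynomial.totalDegree_add _ _).trans (max_le (hu' _) (hv' _))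
      · exact (MvPolynomial.totalDegree_sub _ _).trans (max_le (hu' _) (hv' _))
      · rw [Finset.sum_insert hm, hab]
        have : MvPolynomial.monomial m c =
            4 * (MvPolynomial.monomial u (c / 2) * MvPolynomial.monomial v (1 / 2)) := by
          rw [MvPolynomial.monomial_mul, huv,
            show (4 : MvPolynomial (Fin n) ℝ) = MvPolynomial.C 4 from (map_ofNat MvPolynomial.C 4).symm,
            MvPolynomial.C_mul_monomial]
          congr 1; ring
        rw [this]; ring
  obtain ⟨a, ha, b, hb, h⟩ := key p.support fun m hm =>
    (MvPolynomial.le_totalDegree hm).trans hp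
  exact ⟨a, ha, b, hb, by rw [← h]; exact p.as_sum⟩

theorem add_mem_sosCertified {n d : ℕ} {G : Finset (MvPolynomial (Fin n) ℝ)}
    {p q : MvPolynomial (Fin n) ℝ} (hp : p ∈ sosCertified G d) (hq : q ∈ sosCertified G d) :
    p + q ∈ sosCertified G d := by
  obtain ⟨a, ha, s, hs, rfl⟩ := hp
  obtain ⟨b, hb, t, ht, rfl⟩ := hq
  refine ⟨a + b, add_mem_sumsOfSquares ha hb, fun g => s g + t g,
    fun g hg => add_mem_sumsOfSquares (hs g hg) (ht g hg), ?_⟩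
  simp only [add_mul, Finset.sum_add_distrib]
  ring

theorem sumsOfSquares_subset_sosCertified {n d : ℕ} (G : Finset (MvPolynomial (Fin n) ℝ)) :
    sumsOfSquares n ((2 * d + maxDegree G) ⌈/⌉ 2) ⊆ sosCertified G d := fun p hp =>
  ⟨p, hp, fun _ => 0, fun _ _ => zero_mem_sumsOfSquares, by simp⟩

theorem mul_mem_sosCertified {n d : ℕ} {G : Finset (MvPolynomial (Fin n) ℝ)}
    {s g : MvPolynomial (Fin n) ℝ} (hs : s ∈ sumsOfSquares n d) (hg : g ∈ G) :
    s * g ∈ sosCertified G d := by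
  classical
  refine ⟨0, zero_mem_sumsOfSquares, fun h => if h = g then s else 0, fun h _ => ?_, ?_⟩
  · dsimp only
    split_ifs
    exacts [hs, zero_mem_sumsOfSquares]
  · simp [hg]

theorem eval_nonneg_of_mem_sosCertified {n d : ℕ} {G : Finset (MvPolynomial (Fin n) ℝ)}
    {p : MvPolynomial (Fin n) ℝ} (hp : p ∈ sosCertified G d) {x : Fin n → ℝ}
    (hx : x ∈ semialgebraicSet G) : 0 ≤ MvPolynomial.eval x p := by
  obtain ⟨a, ha, s, hs, rfl⟩ := hp
  simp only [map_add, map_sum, map_mul]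
  exact add_nonneg (eval_nonneg_of_mem_sumsOfSquares ha x) (Finset.sum_nonneg fun g hg =>
    mul_nonneg (eval_nonneg_of_mem_sumsOfSquares (hs g hg) x) (hx g hg))

/-- A polynomial vanishing on the Boolean cube is certified by the Boolean axioms. -/
theorem mem_sosCertified_of_eval_eq_zero {n d : ℕ} {G : Finset (MvPolynomial (Fin n) ℝ)}
    (hG : booleanAxioms n ⊆ G) {p : MvPolynomial (Fin n) ℝ} (hp : p.totalDegree ≤ 2 * d + 2)
    (h0 : ∀ x : Fin n → ℝ, (∀ i, x i = 0 ∨ x i = 1) → MvPolynomial.eval x p = 0) :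
    p ∈ sosCertified G d := by
  classical
  -- The degree control in the Nullstellensatz is essential: the coefficient of each `xᵢ² - xᵢ` must
  -- have degree at most `2 * d`.
  obtain ⟨h, hdeg, hsum⟩ :=
    MvPolynomial.combinatorial_nullstellensatz_exists_linearCombination
      (fun _ : Fin n => ({0, 1} : Finset ℝ)) (by simp) p (fun x hx => h0 x (by simpa using hx))
  have hprod : ∀ i : Fin n, (∏ r ∈ ({0, 1} : Finset ℝ), (MvPolynomial.X i - MvPolynomial.C r)) =
      (MvPolynomial.X i ^ 2 - MvPolynomial.X i : MvPolynomial (Fin n) ℝ) := by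
    intro i
    rw [Finset.prod_pair (by norm_num)]
    simp only [map_zero, map_one]
    ring
  simp only [hprod] at hdeg hsum
  have hdegX : ∀ i : Fin n,
      (MvPolynomial.X i ^ 2 - MvPolynomial.X i : MvPolynomial (Fin n) ℝ).totalDegree = 2 := by
    intro i
    rw [sub_eq_add_neg, MvPolynomial.totalDegree_add_eq_left_of_totalDegree_lt]
    · simp
    · simp
  have hne : ∀ i : Fin n, (MvPolynomial.X i ^ 2 - MvPolynomial.X i : MvPolynomial (Fin n) ℝ) ≠ 0 := by
    intro i hi
    have := hdegX i
    rw [hi] at this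
    simp at this
  have hh : ∀ i, (h i).totalDegree ≤ 2 * d := by
    intro i
    by_cases hi : h i = 0
    · simp [hi]
    have h1 := (hdeg i).trans hp
    rw [MvPolynomial.totalDegree_mul_of_isDomain (hne i) hi, hdegX] at h1
    omega
  rw [Finsupp.linearCombination_apply, Finsupp.sum_fintype _ _ (by simp)] at hsum
  have hmem : ∀ i, h i * (MvPolynomial.X i ^ 2 - MvPolynomial.X i) ∈ sosCertified G d := by
    intro i
    obtain ⟨a, ha, b, hb, hab⟩ := exists_sub_mem_sumsOfSquares (h i) (hh i)
    have h1 := mul_mem_sosCertified (G := G) ha (g := MvPolynomial.X i ^ 2 - MvPolynomial.X i)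
      (hG (by simp [booleanAxioms]))
    have h2 := mul_mem_sosCertified (G := G) hb (g := -(MvPolynomial.X i ^ 2 - MvPolynomial.X i))
      (hG (Finset.mem_union_right _ (Finset.mem_image_of_mem _ (Finset.mem_univ i))))
    have h3 := add_mem_sosCertified h1 h2
    rw [hab]
    convert h3 using 1
    ring
  rw [hsum]
  refine Finset.sum_induction _ (· ∈ sosCertified G d) (fun _ _ => add_mem_sosCertified)
    (sumsOfSquares_subset_sosCertified G zero_mem_sumsOfSquares) fun i _ => ?_
  simpa using hmem i

/-! ### Polynomials in `x₁ + ⋯ + xₙ` on the Boolean cube -/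

/-- A real polynomial that is nonnegative on an interval up to finitely many points is
nonnegative on the whole interval. -/
theorem eval_nonneg_of_finite_exception {a b : ℝ} (hab : a < b) {p : Polynomial ℝ} {F : Set ℝ}
    (hF : F.Finite) (hp : ∀ t ∈ Set.Icc a b, t ∉ F → 0 ≤ p.eval t) :
    ∀ t ∈ Set.Icc a b, 0 ≤ p.eval t := by
  have hd : Dense Fᶜ := hF.countable.dense_compl ℝ
  have h1 : Set.Icc a b ⊆ closure (Set.Ioo a b ∩ Fᶜ) := by
    rw [← closure_Ioo hab.ne]
    exact closure_minimal (hd.open_subset_closure_inter isOpen_Ioo) isClosed_closure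
  have h2 : closure (Set.Ioo a b ∩ Fᶜ) ⊆ {t | 0 ≤ p.eval t} :=
    closure_minimal (fun t ht => hp t (Set.Ioo_subset_Icc_self ht.1) ht.2)
      (isClosed_le continuous_const p.continuous)
  exact fun t ht => h2 (h1 ht)

theorem totalDegree_mkObjective_le {n : ℕ} : (mkObjective n).totalDegree ≤ 1 :=
  MvPolynomial.totalDegree_finsetSum_le fun i _ => by simp

theorem eval_mkObjective {n : ℕ} (x : Fin n → ℝ) :
    MvPolynomial.eval x (mkObjective n) = ∑ i, x i := by
  simp [mkObjective]

theorem totalDegree_aeval_mkObjective_le {n : ℕ} (p : Polynomial ℝ) :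
    (Polynomial.aeval (mkObjective n) p).totalDegree ≤ p.natDegree := by
  rw [Polynomial.aeval_eq_sum_range]
  refine MvPolynomial.totalDegree_finsetSum_le fun i hi => ?_
  refine (MvPolynomial.totalDegree_smul_le _ _).trans ((MvPolynomial.totalDegree_pow _ _).trans ?_)
  have h1 := totalDegree_mkObjective_le (n := n)
  have h2 := Finset.mem_range_succ_iff.1 hi
  nlinarith

theorem eval_aeval_mkObjective {n : ℕ} (p : Polynomial ℝ) (x : Fin n → ℝ) :
    MvPolynomial.eval x (Polynomial.aeval (mkObjective n) p) = p.eval (∑ i, x i) := by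
  have : MvPolynomial.eval x (Polynomial.aeval (mkObjective n) p) =
      Polynomial.aeval (MvPolynomial.aeval x (mkObjective n)) p := by
    rw [← MvPolynomial.coe_aeval_eq_eval]
    exact (Polynomial.aeval_algHom_apply (MvPolynomial.aeval x) _ p).symm
  rw [this]
  simp [mkObjective, Polynomial.aeval_def, Polynomial.eval₂_eq_eval_map]

/-- `f` agrees on the Boolean cube with a sum of squares of polynomials of degree at most `k`. -/
def IsCubeSoS (n k : ℕ) (f : (Fin n → ℝ) → ℝ) : Prop :=
  ∃ s ∈ sumsOfSquares n k, ∀ x : Fin n → ℝ, (∀ i, x i = 0 ∨ x i = 1) →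
    MvPolynomial.eval x s = f x

namespace IsCubeSoS

variable {n k l : ℕ} {f g : (Fin n → ℝ) → ℝ}

theorem mono (h : k ≤ l) (hf : IsCubeSoS n k f) : IsCubeSoS n l f := by
  obtain ⟨s, hs, hsf⟩ := hf
  exact ⟨s, sumsOfSquares_mono h hs, hsf⟩

theorem add (hf : IsCubeSoS n k f) (hg : IsCubeSoS n k g) :
    IsCubeSoS n k fun x => f x + g x := by
  obtain ⟨s, hs, hsf⟩ := hf
  obtain ⟨t, ht, htg⟩ := hg
  exact ⟨s + t, add_mem_sumsOfSquares hs ht, fun x hx => by simp [hsf x hx, htg x hx]⟩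

theorem mul (hf : IsCubeSoS n k f) (hg : IsCubeSoS n l g) :
    IsCubeSoS n (k + l) fun x => f x * g x := by
  obtain ⟨s, hs, hsf⟩ := hf
  obtain ⟨t, ht, htg⟩ := hg
  exact ⟨s * t, mul_mem_sumsOfSquares hs ht, fun x hx => by simp [hsf x hx, htg x hx]⟩

theorem const {c : ℝ} (hc : 0 ≤ c) : IsCubeSoS n k fun _ => c :=
  ⟨_, C_mem_sumsOfSquares hc, fun x _ => by simp⟩

/-- On the cube `xᵢ = xᵢ²`. -/
theorem sum_coord : IsCubeSoS n 1 fun x => ∑ i, x i := by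
  refine ⟨_, mem_sumsOfSquares_of_fintype (fun i : Fin n => MvPolynomial.X i) (by simp), ?_⟩
  intro x hx
  simp only [map_sum, map_pow, MvPolynomial.eval_X]
  refine Finset.sum_congr rfl fun i _ => ?_
  rcases hx i with h | h <;> simp [h]

theorem card_sub_sum_coord : IsCubeSoS n 1 fun x => n - ∑ i, x i := by
  refine ⟨_, mem_sumsOfSquares_of_fintype (fun i : Fin n => 1 - MvPolynomial.X i) (k := 1)
    (fun i => (MvPolynomial.totalDegree_sub _ _).trans (by simp)), ?_⟩
  intro x hx
  simp only [map_sum, map_pow, map_sub, map_one, MvPolynomial.eval_X]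
  calc _ = ∑ i, (1 - x i) := by
        refine Finset.sum_congr rfl fun i _ => ?_
        rcases hx i with h | h <;> simp [h]
    _ = _ := by simp

/-- On the cube this is `∑_{i ≠ j} (xᵢ xⱼ)²`. It is negative for real sums in `(0, 1)`, so
integrality enters the upper bound here. -/
theorem sum_mul_sum_sub_one : IsCubeSoS n 2 fun x => (∑ i, x i) * (∑ i, x i - 1) := by
  classical
  refine ⟨_, mem_sumsOfSquares_of_fintype (k := 2) (fun p : Fin n × Fin n =>
    if p.1 = p.2 then 0 else MvPolynomial.X p.1 * MvPolynomial.X p.2) (fun p => ?_), ?_⟩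
  · split_ifs
    · simp
    · exact (MvPolynomial.totalDegree_mul _ _).trans (by simp)
  · intro x hx
    have hsq : ∀ i, x i ^ 2 = x i := fun i => by rcases hx i with h | h <;> simp [h]
    have h1 : ∑ i, x i = ∑ i, ∑ j, if i = j then x i * x j else 0 := by
      simp [← pow_two, hsq]
    dsimp only
    rw [mul_sub, mul_one, Finset.sum_mul_sum]
    conv_rhs => arg 2; rw [h1]
    rw [← Finset.sum_sub_distrib, Fintype.sum_prod_type, map_sum]
    refine Finset.sum_congr rfl fun i _ => ?_
    rw [← Finset.sum_sub_distrib, map_sum]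
    refine Finset.sum_congr rfl fun j _ => ?_
    split_ifs <;> simp [mul_pow, hsq]

theorem sq_eval_sum (p : Polynomial ℝ) : IsCubeSoS n p.natDegree fun x => p.eval (∑ i, x i) ^ 2 := by
  exact ⟨_, sq_mem_sumsOfSquares (totalDegree_aeval_mkObjective_le p), fun x _ => by
    rw [map_pow, eval_aeval_mkObjective]⟩

/-- A univariate polynomial that is nonnegative on `[0, n]`, evaluated at `x₁ + ⋯ + xₙ`, is a sum
of squares on the cube. -/
theorem eval_sum_of_nonneg (hn : 1 ≤ n) (p : Polynomial ℝ)
    (hp : ∀ t ∈ Set.Icc (0 : ℝ) n, 0 ≤ p.eval t) :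
    IsCubeSoS n p.natDegree fun x => p.eval (∑ i, x i) := by
  have hn0 : (0 : ℝ) < n := by exact_mod_cast hn
  induction hN : p.natDegree using Nat.strong_induction_on generalizing p with
  | _ N ih =>
  -- Splitting off a nonnegative factor `q` leaves a cofactor that is nonnegative off the roots of
  -- `q`, hence everywhere on `[0, n]`. The factors come from a complex root `z`: `t - r` for `r ≤
  -- 0`, `r - t` for `r ≥ n`, `(t - r)²` for `0 < r < n`, and `(t - Re z)² + (Im z)²` for nonreal
  -- `z`.
  have step : ∀ q r : Polynomial ℝ, p = q * r → 1 ≤ q.natDegree →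
      (∀ t ∈ Set.Icc (0 : ℝ) n, 0 ≤ q.eval t) →
      IsCubeSoS n q.natDegree (fun x => q.eval (∑ i, x i)) →
      IsCubeSoS n N fun x => p.eval (∑ i, x i) := by
    intro q r hqr hq1 hq0 hqS
    by_cases hp0 : p = 0
    · simpa [hp0] using const (n := n) (k := N) le_rfl
    have hq : q ≠ 0 := fun h => hp0 (by simp [hqr, h])
    have hr : r ≠ 0 := fun h => hp0 (by simp [hqr, h])
    have hdeg : N = q.natDegree + r.natDegree := by
      rw [← hN, hqr, Polynomial.natDegree_mul hq hr]
    have hrS := ih r.natDegree (by omega) r (eval_nonneg_of_finite_exception hn0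
      (Polynomial.rootSet_finite q ℝ) fun t ht htF => ?_) rfl
    · rw [hdeg, hqr]
      simpa using hqS.mul hrS
    · have h1 := hp t ht
      have h2 : q.eval t ≠ 0 := fun h => htF (by simp [Polynomial.mem_rootSet, hq, h])
      rw [hqr, Polynomial.eval_mul] at h1
      exact nonneg_of_mul_nonneg_right h1 (lt_of_le_of_ne (hq0 t ht) h2.symm)
  rcases Nat.eq_zero_or_pos N with rfl | hNpos
  · obtain ⟨c, rfl⟩ := Polynomial.natDegree_eq_zero.1 hN
    simpa using const (n := n) (k := 0) (by simpa using hp 0 ⟨le_rfl, hn0.le⟩)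
  obtain ⟨z, hz⟩ := IsAlgClosed.exists_aeval_eq_zero ℂ p
    (fun h => by have := Polynomial.natDegree_eq_zero_iff_degree_le_zero.2 h.le; omega)
  by_cases him : z.im = 0
  · have hroot : p.eval z.re = 0 := by
      have hz' : z = ((z.re : ℝ) : ℂ) := Complex.ext (by simp) (by simp [him])
      rw [hz'] at hz
      have := Polynomial.aeval_algebraMap_apply ℂ z.re p
      simp only [Complex.coe_algebraMap] at this
      rw [this] at hz
      simpa [Polynomial.aeval_def, Polynomial.eval₂_eq_eval_map] using hz
    set r := z.re
    obtain ⟨q, hq⟩ := Polynomial.dvd_iff_isRoot.2 hroot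
    have hlin : ∀ c : ℝ, (fun x : Fin n → ℝ => (Polynomial.X - Polynomial.C c).eval (∑ i, x i)) =
      fun x => ∑ i, x i + -c := by intro c; funext x; simp [sub_eq_add_neg]
    rcases le_or_gt r 0 with hr0 | hr0
    · refine step _ q hq (by simp) (fun t ht => by simpa using hr0.trans ht.1) ?_
      rw [Polynomial.natDegree_X_sub_C, hlin]
      exact sum_coord.add (const (by linarith))
    rcases le_or_gt (n : ℝ) r with hrn | hrn
    · refine step (-(Polynomial.X - Polynomial.C r)) (-q) (by rw [hq]; ring) (by simp [-neg_sub])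
        (fun t ht => by simpa using ht.2.trans hrn) ?_
      rw [Polynomial.natDegree_neg, Polynomial.natDegree_X_sub_C]
      convert card_sub_sum_coord.add (const (n := n) (k := 1) (sub_nonneg.2 hrn)) using 2
      simp
    -- An interior root is at least double: the cofactor is nonnegative to its right and nonpositive
    -- to its left.
    · have hq0 : q.eval r = 0 := by
        have hqr : ∀ t ∈ Set.Icc r n, 0 ≤ q.eval t := by
          refine eval_nonneg_of_finite_exception hrn (Set.finite_singleton r) fun t ht htr => ?_
          have h1 := hp t ⟨hr0.le.trans ht.1, ht.2⟩
          rw [hq, Polynomial.eval_mul] at h1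
          refine nonneg_of_mul_nonneg_right h1 ?_
          simpa using lt_of_le_of_ne ht.1 (Ne.symm htr)
        have hql : ∀ t ∈ Set.Icc 0 r, 0 ≤ (-q).eval t := by
          refine eval_nonneg_of_finite_exception hr0 (Set.finite_singleton r) fun t ht htr => ?_
          have h1 := hp t ⟨ht.1, ht.2.trans hrn.le⟩
          rw [hq, ← neg_mul_neg, Polynomial.eval_mul] at h1
          refine nonneg_of_mul_nonneg_right h1 ?_
          simpa using lt_of_le_of_ne ht.2 htr
        have h1 := hqr r ⟨le_rfl, hrn.le⟩
        have h2 := hql r ⟨hr0.le, le_rfl⟩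
        simp only [Polynomial.eval_neg] at h2
        linarith
      obtain ⟨q', hq'⟩ := Polynomial.dvd_iff_isRoot.2 hq0
      refine step ((Polynomial.X - Polynomial.C r) ^ 2) q' (by rw [hq, hq']; ring) (by simp)
        (fun t _ => by simp; positivity) ?_
      simpa [-Polynomial.eval_sub] using
        (sq_eval_sum (n := n) (Polynomial.X - Polynomial.C r)).mono (l := 2) (by simp)
  · obtain ⟨q, hq⟩ := p.quadratic_dvd_of_aeval_eq_zero_im_ne_zero hz him
    have hquad : ∀ t : ℝ, (Polynomial.X ^ 2 - Polynomial.C (2 * z.re) * Polynomial.X +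
        Polynomial.C (‖z‖ ^ 2)).eval t =
        (Polynomial.X - Polynomial.C z.re).eval t ^ 2 + z.im ^ 2 := by
      intro t
      simp [Complex.sq_norm, Complex.normSq_apply]
      ring
    have hdeg : (Polynomial.X ^ 2 - Polynomial.C (2 * z.re) * Polynomial.X +
        Polynomial.C (‖z‖ ^ 2)).natDegree = 2 := by compute_degree!
    refine step _ q hq (by rw [hdeg]; norm_num) (fun t _ => by rw [hquad]; positivity) ?_
    rw [hdeg]
    simp only [hquad]
    exact ((sq_eval_sum _).mono (by simp)).add (const (sq_nonneg _))

end IsCubeSoS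

/-! ### Chebyshev polynomials and the univariate multiplier -/

open Polynomial.Chebyshev in
/-- The Chebyshev polynomial lies above its tangent at `1`. -/
theorem one_add_sq_mul_le_eval_T (N : ℕ) {y : ℝ} (hy : -1 ≤ y) :
    1 + (N : ℝ) ^ 2 * (y - 1) ≤ (T ℝ N).eval y := by
  have hT : ∀ N : ℤ, (y - 1) ≤ (y - 1) * (T ℝ N).eval y := by
    intro N
    rcases le_total 1 y with h | h
    · nlinarith [one_le_eval_T_real N h]
    · nlinarith [(eval_T_real_mem_Icc N ⟨hy, h⟩).2]
  -- The first difference is carried along because the second one is `2 (y - 1) T_{N+1}(y)`, which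
  -- is at least `2 (y - 1)`.
  have key : 1 + (N : ℝ) ^ 2 * (y - 1) ≤ (T ℝ N).eval y ∧
      (2 * N + 1) * (y - 1) ≤ (T ℝ (N + 1)).eval y - (T ℝ N).eval y := by
    induction N with
    | zero => simp
    | succ N ih =>
      have h1 := hT (N + 1)
      have h2 := congrArg (Polynomial.eval y) (T_add_two ℝ (N : ℤ))
      simp only [Polynomial.eval_sub, Polynomial.eval_mul, Polynomial.eval_X,
        Polynomial.eval_ofNat] at h2
      push_cast
      rw [show (N : ℤ) + 1 + 1 = N + 2 by ring, h2]
      constructor <;> nlinarith [ih.1, ih.2]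
  exact key.1

-- The differences `T_{N+1} - T_N` are also increasing on `[1, ∞)`, since the second difference is
-- `2 (y - 1) T_{N+1}(y)`; both claims go through one induction.
open Polynomial.Chebyshev in
theorem eval_T_le_eval_T (N : ℕ) {y z : ℝ} (hy : 1 ≤ y) (hyz : y ≤ z) :
    (T ℝ N).eval y ≤ (T ℝ N).eval z := by
  have key : (T ℝ N).eval y ≤ (T ℝ N).eval z ∧ (T ℝ (N + 1)).eval y - (T ℝ N).eval y ≤
      (T ℝ (N + 1)).eval z - (T ℝ N).eval z := by
    induction N with
    | zero => simpa using hyz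
    | succ N ih =>
      have h2 : ∀ y, _ := fun y => congrArg (Polynomial.eval y) (T_add_two ℝ (N : ℤ))
      simp only [Polynomial.eval_sub, Polynomial.eval_mul, Polynomial.eval_X,
        Polynomial.eval_ofNat] at h2
      have h3 : (T ℝ (N + 1)).eval y ≤ (T ℝ (N + 1)).eval z := by linarith [ih.1, ih.2]
      have h4 := one_le_eval_T_real (N + 1) hy
      push_cast
      rw [show (N : ℤ) + 1 + 1 = N + 2 by ring, h2, h2]
      refine ⟨h3, ?_⟩
      nlinarith [ih.1, ih.2, mul_le_mul (sub_le_sub_right hyz 1) h3 (by linarith) (by linarith)]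
  exact key.1

/-- A polynomial of degree `O(√n)` equal to `1` at `0` and vanishing at `1`, which stays in
`[-1, 1]` on `[0, 1]` and is small on `[1, n]`. -/
theorem exists_damped_polynomial {n m : ℕ} (hn : 1 ≤ n) (hm : n ≤ m ^ 2) (hm' : m ^ 2 ≤ 4 * n) :
    ∃ q : Polynomial ℝ, q.natDegree ≤ 2 * m ∧ q.eval 0 = 1 ∧ q.eval 1 = 0 ∧
      (∀ t ∈ Set.Icc (0 : ℝ) 1, |q.eval t| ≤ 1) ∧
      ∀ t ∈ Set.Icc (1 : ℝ) n, q.eval t ^ 2 ≤ t - 1 ∧ q.eval t ^ 2 ≤ 1 / 16 := by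
  have hn0 : (0 : ℝ) < n := by exact_mod_cast hn
  have hmR : (n : ℝ) ≤ (m : ℝ) ^ 2 := by exact_mod_cast hm
  have hmR' : (m : ℝ) ^ 2 ≤ 4 * n := by exact_mod_cast hm'
  set T : Polynomial ℝ := Polynomial.Chebyshev.T ℝ ((2 * m : ℕ) : ℤ) with hT
  have htan : ∀ y : ℝ, -1 ≤ y → 1 + 4 * (m : ℝ) ^ 2 * (y - 1) ≤ T.eval y := by
    intro y hy
    refine le_of_eq_of_le ?_ (one_add_sq_mul_le_eval_T (2 * m) hy)
    push_cast
    ring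
  -- This sends `1` to `1`, `[1, n]` into `[-1, 1]`, and `0` to `1 + 2/n`, where the tangent bound
  -- gives `T - 1 ≥ 8 m²/n ≥ 8`. The witness is `Q = T ∘ y - 1` divided by `Q(0)`.
  set y : ℝ → ℝ := fun t => 1 + 2 / n * (1 - t) with hy
  set Q : Polynomial ℝ := T.comp (Polynomial.C (-(2 / n : ℝ)) * Polynomial.X +
    Polynomial.C (1 + 2 / n : ℝ)) - 1 with hQ
  have hQe : ∀ t, Q.eval t = T.eval (y t) - 1 := by
    intro t
    simp only [hQ, hy, Polynomial.eval_sub, Polynomial.eval_comp, Polynomial.eval_add,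
      Polynomial.eval_mul, Polynomial.eval_C, Polynomial.eval_X, Polynomial.eval_one]
    congr 2
    ring
  have hK : 8 ≤ Q.eval 0 := by
    have h1 := htan (y 0) (by simp only [hy]; have : 0 < 2 / (n : ℝ) := by positivity
                              linarith)
    have h2 : 8 ≤ 4 * (m : ℝ) ^ 2 * (y 0 - 1) := by
      have : 4 * (m : ℝ) ^ 2 * (y 0 - 1) = 8 * ((m : ℝ) ^ 2 / n) := by simp only [hy]; ring
      rw [this]
      have := (one_le_div hn0).2 hmR
      linarith
    rw [hQe]
    linarith
  have hK0 : 0 < Q.eval 0 := by linarith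
  have hev : ∀ t, (Polynomial.C (Q.eval 0)⁻¹ * Q).eval t = Q.eval t / Q.eval 0 := by
    intro t
    rw [Polynomial.eval_mul, Polynomial.eval_C]
    ring
  refine ⟨Polynomial.C (Q.eval 0)⁻¹ * Q, ?_, ?_, ?_, ?_, ?_⟩
  · refine (Polynomial.natDegree_C_mul_le _ _).trans ?_
    refine (Polynomial.natDegree_sub_le _ _).trans (max_le ?_ (by simp))
    rw [Polynomial.natDegree_comp]
    calc _ ≤ 2 * m * 1 := Nat.mul_le_mul (by rw [hT, Polynomial.Chebyshev.natDegree_T, Int.natAbs_natCast])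
          Polynomial.natDegree_linear_le
      _ = _ := mul_one _
  · rw [hev, div_self hK0.ne']
  · rw [hev, hQe]
    simp [hy, hT]
  · intro t ht
    have hb : 0 < 2 / (n : ℝ) := by positivity
    have h1 : 1 ≤ y t := by simp only [hy]; nlinarith [ht.2]
    have h2 : y t ≤ y 0 := by simp only [hy]; nlinarith [ht.1]
    have h3 := Polynomial.Chebyshev.one_le_eval_T_real ((2 * m : ℕ) : ℤ) h1
    have h4 := eval_T_le_eval_T (2 * m) h1 h2
    rw [hev, abs_le, le_div_iff₀ hK0, div_le_iff₀ hK0, hQe, hQe]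
    rw [hQe] at hK0
    constructor <;> linarith
  · intro t ht
    have hb : 0 < 2 / (n : ℝ) := by positivity
    have h1 : y t ≤ 1 := by simp only [hy]; nlinarith [ht.1]
    have h2 : -1 ≤ y t := by
      have : 2 / (n : ℝ) * n = 2 := by field_simp
      simp only [hy]
      nlinarith [ht.2]
    obtain ⟨h3, h4⟩ := Polynomial.Chebyshev.eval_T_real_mem_Icc ((2 * m : ℕ) : ℤ) ⟨h2, h1⟩
    have h5 := htan _ h2
    have h6 : 4 * (m : ℝ) ^ 2 * (y t - 1) ≥ -32 * (t - 1) := by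
      have : 4 * (m : ℝ) ^ 2 * (y t - 1) = -(8 * ((m : ℝ) ^ 2 / n) * (t - 1)) := by
        simp only [hy]; ring
      rw [this]
      have := (div_le_iff₀ hn0).2 hmR'
      nlinarith [ht.1]
    rw [hev, div_pow, div_le_iff₀ (by positivity), div_le_iff₀ (by positivity)]
    have h7 : 64 ≤ Q.eval 0 ^ 2 := by nlinarith
    -- Here `-2 ≤ Q(t) ≤ 0` and `Q(t) ≥ -32 (t - 1)`.
    have h8 : Q.eval t ^ 2 ≤ 64 * (t - 1) := by rw [hQe]; nlinarith
    have h9 : Q.eval t ^ 2 ≤ 4 := by rw [hQe]; nlinarith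
    constructor
    · nlinarith [ht.1]
    · linarith

/-- A polynomial witnessing, at the univariate level, the exactness of the SoS program. -/
theorem exists_multiplier_polynomial {n m M : ℕ} {P : ℝ} (hn : 1 ≤ n) (hm : n ≤ m ^ 2)
    (hm' : m ^ 2 ≤ 4 * n) (hM : 2 * P ≤ 16 ^ M) :
    ∃ q : Polynomial ℝ, q.natDegree ≤ (M + 1) * (2 * m) ∧ q.eval 0 = 1 ∧ q.eval 1 = 0 ∧
      (∀ t ∈ Set.Icc (0 : ℝ) 1, q.eval t ^ 2 ≤ 1) ∧
      ∀ t ∈ Set.Icc (1 : ℝ) n, q.eval t ^ 2 * (P * t - 1) ≤ t - 1 := by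
  obtain ⟨q, hdeg, h0, h1, hle, hs⟩ := exists_damped_polynomial hn hm hm'
  refine ⟨q ^ (M + 1), (Polynomial.natDegree_pow_le).trans (Nat.mul_le_mul_left _ hdeg),
    by simp [h0], by simp [h1], fun t ht => ?_, fun t ht => ?_⟩
  · rw [Polynomial.eval_pow, ← sq_abs, abs_pow]
    exact pow_le_one₀ (by positivity) (pow_le_one₀ (abs_nonneg _) (hle t ht))
  · obtain ⟨hs1, hs2⟩ := hs t ht
    have ht1 := ht.1
    set u := q.eval t ^ 2
    have hu : 0 ≤ u := sq_nonneg _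
    have hpow : (q ^ (M + 1)).eval t ^ 2 = u ^ M * u := by
      rw [Polynomial.eval_pow, ← pow_mul, mul_comm, pow_mul, pow_succ]
    have huM : u ^ M * 16 ^ M ≤ 1 := by
      rw [← mul_pow]
      exact pow_le_one₀ (by positivity) (by linarith)
    have huM0 : 0 ≤ u ^ M := by positivity
    have huP : u ^ M * (2 * P) ≤ 1 := (mul_le_mul_of_nonneg_left hM huM0).trans huM
    rw [hpow]
    have h3 : u ^ M * u * (P * t - 1) ≤ u * t / 2 := by
      have : u * t * (u ^ M * (2 * P)) ≤ u * t * 1 :=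
        mul_le_mul_of_nonneg_left huP (by positivity)
      nlinarith [mul_nonneg huM0 hu]
    -- For `t ≤ 2` use `u ≤ t - 1` and `t / 2 ≤ 1`; for `t ≥ 2` use `u ≤ 1 / 16`.
    rcases le_total t 2 with h | h <;> nlinarith

/-! ### The Min Knapsack instance -/

/-- Because of the ceiling, this already allows squares of polynomials of degree `d + 1` in `s₀`. -/
theorem one_le_maxDegree_mkConstraints {n : ℕ} (hn : 1 ≤ n) (P : ℝ) :
    1 ≤ maxDegree (mkConstraints n P) := by
  classical
  have hmem : (mkObjective n - MvPolynomial.C (1 / P)) ∈ mkConstraints n P := by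
    simp [mkConstraints]
  refine le_trans ?_ (Finset.le_sup (f := MvPolynomial.totalDegree) hmem)
  by_contra h
  have h0 := MvPolynomial.totalDegree_eq_zero_iff_eq_C.1 (Nat.lt_one_iff.1 (not_le.1 h))
  have h1 := congrArg (MvPolynomial.eval fun _ : Fin n => (0 : ℝ)) h0
  have h2 := congrArg (MvPolynomial.eval fun _ : Fin n => (1 : ℝ)) h0
  rw [MvPolynomial.eval_C] at h1 h2
  rw [← h2] at h1
  have hn1 : (1 : ℝ) ≤ n := by exact_mod_cast hn
  simp [mkObjective] at h1
  linarith

theorem mem_semialgebraicSet_mkConstraints {n : ℕ} {P : ℝ} {x : Fin n → ℝ} :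
    x ∈ semialgebraicSet (mkConstraints n P) ↔
      (∀ i, x i = 0 ∨ x i = 1) ∧ 1 / P ≤ ∑ i, x i := by
  classical
  have h01 : ∀ a : ℝ, (0 ≤ a ^ 2 - a ∧ 0 ≤ -(a ^ 2 - a)) ↔ (a = 0 ∨ a = 1) := by
    intro a
    constructor
    · rintro ⟨h1, h2⟩
      have : a * (a - 1) = 0 := by linarith
      rcases mul_eq_zero.1 this with h | h
      · exact Or.inl h
      · exact Or.inr (by linarith)
    · rintro (rfl | rfl) <;> simp
  constructor
  · intro h
    refine ⟨fun i => (h01 _).1 ⟨?_, ?_⟩, ?_⟩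
    · have := h (MvPolynomial.X i ^ 2 - MvPolynomial.X i)
        (by simp [mkConstraints, booleanAxioms])
      rwa [map_sub, map_pow, MvPolynomial.eval_X] at this
    · have := h (-(MvPolynomial.X i ^ 2 - MvPolynomial.X i))
        (Finset.mem_union_left _ (Finset.mem_union_right _
          (Finset.mem_image_of_mem _ (Finset.mem_univ i))))
      rwa [map_neg, map_sub, map_pow, MvPolynomial.eval_X] at this
    · have := h (mkObjective n - MvPolynomial.C (1 / P)) (by simp [mkConstraints])
      rwa [map_sub, eval_mkObjective, MvPolynomial.eval_C, sub_nonneg] at this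
  · rintro ⟨hx, hs⟩ g hg
    simp only [mkConstraints, booleanAxioms, Finset.mem_union, Finset.mem_image, Finset.mem_univ,
      true_and, Finset.mem_singleton] at hg
    rcases hg with (⟨i, rfl⟩ | ⟨i, rfl⟩) | rfl
    · simpa using ((h01 _).2 (hx i)).1
    · simpa using ((h01 _).2 (hx i)).2
    · simpa [eval_mkObjective] using hs

theorem exists_natCast_eq_sum {n : ℕ} {x : Fin n → ℝ} (hx : ∀ i, x i = 0 ∨ x i = 1) :
    ∃ k : ℕ, ∑ i, x i = k := by
  classical
  refine ⟨(Finset.univ.filter fun i => x i = 1).card, ?_⟩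
  rw [Finset.card_filter, Nat.cast_sum]
  refine Finset.sum_congr rfl fun i _ => ?_
  rcases hx i with h | h <;> simp [h]

/-- The optimum of the Min Knapsack instance is `1`. -/
theorem isLeast_mkObjective {n : ℕ} (hn : 1 ≤ n) {P : ℝ} (hP : 1 ≤ P) :
    IsLeast ((fun x => MvPolynomial.eval x (mkObjective n)) ''
      semialgebraicSet (mkConstraints n P)) 1 := by
  constructor
  · refine ⟨Pi.single ⟨0, hn⟩ 1, mem_semialgebraicSet_mkConstraints.2 ⟨fun i => ?_, ?_⟩, ?_⟩
    · by_cases h : i = ⟨0, hn⟩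
      · subst h; simp
      · simp [h]
    · rw [Fintype.sum_pi_single']
      exact (div_le_one (by linarith)).2 hP
    · simp only [eval_mkObjective]
      exact Fintype.sum_pi_single' _ _
  · rintro _ ⟨x, hx, rfl⟩
    obtain ⟨hx, hs⟩ := mem_semialgebraicSet_mkConstraints.1 hx
    obtain ⟨k, hk⟩ := exists_natCast_eq_sum hx
    simp only [eval_mkObjective]
    rw [hk] at hs ⊢
    have : (0 : ℝ) < k := lt_of_lt_of_le (by positivity) hs
    exact_mod_cast this

/-- Evaluating a certificate at an optimal point shows that no certified bound exceeds `1`. -/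
theorem soSExact_mkConstraints_iff {n d : ℕ} (hn : 1 ≤ n) {P : ℝ} (hP : 1 ≤ P) :
    SoSExact (mkConstraints n P) (mkObjective n) d ↔
      mkObjective n - MvPolynomial.C 1 ∈ sosCertified (mkConstraints n P) d := by
  have hl := isLeast_mkObjective hn hP
  constructor
  · rintro ⟨v, hv, hg⟩
    rw [hl.unique hv]
    exact hg.1
  · intro h
    refine ⟨1, hl, h, fun l hlm => ?_⟩
    obtain ⟨x, hx, hx1⟩ := hl.1
    have := eval_nonneg_of_mem_sosCertified hlm hx
    dsimp only at hx1
    rw [map_sub, hx1, MvPolynomial.eval_C] at this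
    linarith

/-! ### The upper bound -/

/-- A suitable univariate multiplier of degree `e` yields an exact certificate of degree
`2 * e + 1`. -/
theorem soSExact_of_multiplier {n e : ℕ} (hn : 1 ≤ n) {P : ℝ} (hP : 1 ≤ P) {q : Polynomial ℝ}
    (hdeg : q.natDegree ≤ e) (h0 : q.eval 0 = 1) (h1 : q.eval 1 = 0)
    (hle : ∀ t ∈ Set.Icc (0 : ℝ) 1, q.eval t ^ 2 ≤ 1)
    (hs : ∀ t ∈ Set.Icc (1 : ℝ) n, q.eval t ^ 2 * (P * t - 1) ≤ t - 1) :
    SoSExact (mkConstraints n P) (mkObjective n) (2 * e + 1) := by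
  classical
  rw [soSExact_mkConstraints_iff hn hP]
  set R : Polynomial ℝ := Polynomial.X - Polynomial.C 1 -
    q ^ 2 * (Polynomial.C P * Polynomial.X + Polynomial.C (-1)) with hR
  have hRe : ∀ t, R.eval t = t - 1 - q.eval t ^ 2 * (P * t - 1) := by
    intro t; simp [hR, ← sub_eq_add_neg]
  have hRdeg : R.natDegree ≤ 2 * e + 1 := by
    refine (Polynomial.natDegree_sub_le _ _).trans (max_le ?_ ?_)
    · rw [Polynomial.natDegree_X_sub_C]; omega
    · refine Polynomial.natDegree_mul_le.trans (add_le_add ?_ Polynomial.natDegree_linear_le)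
      exact Polynomial.natDegree_pow_le.trans (Nat.mul_le_mul_left _ hdeg)
  obtain ⟨W₁, hW₁⟩ := Polynomial.dvd_iff_isRoot.2 (show R.IsRoot 0 by
    rw [Polynomial.IsRoot, hRe, h0]; ring)
  obtain ⟨W, hW⟩ := Polynomial.dvd_iff_isRoot.2 (show W₁.IsRoot 1 by
    have : R.eval 1 = 0 := by rw [hRe, h1]; ring
    rw [hW₁] at this
    simpa using this)
  have hRW : R = (Polynomial.X - Polynomial.C 0) * ((Polynomial.X - Polynomial.C 1) * W) := by
    rw [hW₁, hW]
  have hRWe : ∀ t, R.eval t = t * (t - 1) * W.eval t := by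
    intro t; rw [hRW]; simp; ring
  have hWdeg : W.natDegree ≤ 2 * e := by
    by_cases hW0 : W = 0
    · simp [hW0]
    have h2 : ((Polynomial.X - Polynomial.C 1) * W : Polynomial ℝ) ≠ 0 :=
      mul_ne_zero (Polynomial.X_sub_C_ne_zero 1) hW0
    rw [hRW, Polynomial.natDegree_mul (Polynomial.X_sub_C_ne_zero 0) h2,
      Polynomial.natDegree_mul (Polynomial.X_sub_C_ne_zero 1) hW0] at hRdeg
    simp only [Polynomial.natDegree_X_sub_C] at hRdeg
    omega
  have hWnn : ∀ t ∈ Set.Icc (0 : ℝ) n, 0 ≤ W.eval t := by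
    refine eval_nonneg_of_finite_exception (F := {0, 1}) (by exact_mod_cast hn) (by simp) ?_
    intro t ht htF
    simp only [Set.mem_insert_iff, Set.mem_singleton_iff, not_or] at htF
    have ht0 : 0 < t := lt_of_le_of_ne ht.1 (Ne.symm htF.1)
    have h3 := hRWe t
    rw [hRe] at h3
    rcases lt_or_gt_of_ne htF.2 with ht1 | ht1
    · have h4 : t - 1 - q.eval t ^ 2 * (P * t - 1) ≤ 0 := by
        have h5 := hle t ⟨ht0.le, ht1.le⟩
        have h6 := sq_nonneg (q.eval t)
        rcases le_total (P * t) 1 with h | h <;> nlinarith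
      have h5 : t * (t - 1) < 0 := by nlinarith
      by_contra h6
      nlinarith [mul_pos_of_neg_of_neg h5 (not_le.1 h6)]
    · have h4 := hs t ⟨ht1.le, ht.2⟩
      have h5 : 0 < t * (t - 1) := mul_pos ht0 (by linarith)
      refine nonneg_of_mul_nonneg_right (b := W.eval t) ?_ h5
      linarith
  obtain ⟨s₀, hs₀, hs₀e⟩ := IsCubeSoS.sum_mul_sum_sub_one.mul
    ((IsCubeSoS.eval_sum_of_nonneg hn W hWnn).mono hWdeg)
  set a : MvPolynomial (Fin n) ℝ := Polynomial.aeval (mkObjective n) q with ha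
  have hadeg : a.totalDegree ≤ 2 * e + 1 :=
    (totalDegree_aeval_mkObjective_le q).trans (by omega)
  set s₁ : MvPolynomial (Fin n) ℝ := MvPolynomial.C P * a ^ 2 with hs₁
  have hs₁m : s₁ ∈ sumsOfSquares n (2 * e + 1) := by
    have := mul_mem_sumsOfSquares (C_mem_sumsOfSquares (n := n) (k := 0) (zero_le_one.trans hP))
      (sq_mem_sumsOfSquares hadeg)
    rwa [zero_add] at this
  have hobj := totalDegree_mkObjective_le (n := n)
  have hg : (mkObjective n - MvPolynomial.C (1 / P)).totalDegree ≤ 1 :=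
    (MvPolynomial.totalDegree_sub _ _).trans (max_le hobj (by simp))
  -- The identity holds only on the cube; the Boolean axioms absorb the difference within degree `2
  -- * (2 * e + 1) + 2`.
  have hcube : mkObjective n - MvPolynomial.C 1 - s₀ -
      s₁ * (mkObjective n - MvPolynomial.C (1 / P)) ∈
      sosCertified (mkConstraints n P) (2 * e + 1) := by
    refine mem_sosCertified_of_eval_eq_zero Finset.subset_union_left ?_ fun x hx => ?_
    · refine (MvPolynomial.totalDegree_sub _ _).trans (max_le
        ((MvPolynomial.totalDegree_sub _ _).trans (max_le
          ((MvPolynomial.totalDegree_sub _ _).trans (max_le (hobj.trans (by omega)) (by simp)))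
          ((totalDegree_le_of_mem_sumsOfSquares hs₀).trans (by omega))))
        ((MvPolynomial.totalDegree_mul _ _).trans
          ((add_le_add (totalDegree_le_of_mem_sumsOfSquares hs₁m) hg).trans (by omega))))
    · have h3 := hRWe (∑ i, x i)
      rw [hRe] at h3
      have hP0 : P ≠ 0 := by linarith
      simp only [map_sub, map_mul, map_pow, hs₁, ha, eval_aeval_mkObjective, eval_mkObjective,
        MvPolynomial.eval_C, hs₀e x hx, ← h3]
      field_simp
      ring
  have hmem : (mkObjective n - MvPolynomial.C (1 / P)) ∈ mkConstraints n P := by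
    simp [mkConstraints]
  have hs₀' : s₀ ∈ sosCertified (mkConstraints n P) (2 * e + 1) := by
    refine sumsOfSquares_subset_sosCertified _ (sumsOfSquares_mono ?_ hs₀)
    have := one_le_maxDegree_mkConstraints hn P
    rw [Nat.ceilDiv_eq_add_pred_div]
    omega
  convert add_mem_sosCertified (add_mem_sosCertified hcube hs₀') (mul_mem_sosCertified hs₁m hmem)
    using 1
  ring

/-- The SoS program is exact already in degree `O(√n log P)`. -/
theorem exists_soSExact_le {n : ℕ} (hn : 1 ≤ n) {P : ℝ} (hP : 2 ≤ P) :
    ∃ d : ℕ, SoSExact (mkConstraints n P) (mkObjective n) d ∧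
      (d : ℝ) ≤ 34 * (Real.sqrt n * Real.log P) := by
  have hn1 : (1 : ℝ) ≤ n := by exact_mod_cast hn
  have hsq1 : 1 ≤ Real.sqrt n := Real.one_le_sqrt.2 hn1
  have hsq := Real.sq_sqrt (zero_le_one.trans hn1)
  set m := ⌈Real.sqrt n⌉₊ with hm
  set M := ⌈Real.log P⌉₊ with hM
  have hlog : 0.69 < Real.log P := by
    have := Real.log_le_log (by norm_num) hP
    linarith [Real.log_two_gt_d9]
  have hm1 : Real.sqrt n ≤ m := Nat.le_ceil _
  have hm2 : (m : ℝ) ≤ 2 * Real.sqrt n := by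
    linarith [Nat.ceil_lt_add_one (Real.sqrt_nonneg n)]
  have hM1 : Real.log P ≤ M := Nat.le_ceil _
  have hM2 : (M : ℝ) + 1 ≤ 4 * Real.log P := by
    linarith [Nat.ceil_lt_add_one (show 0 ≤ Real.log P by linarith)]
  -- From `P ≤ e^M ≤ 4^M` and `2 P ≤ P²`.
  have hPM : 2 * P ≤ 16 ^ M := by
    have h1 : P ≤ Real.exp M := (Real.log_le_iff_le_exp (by linarith)).1 hM1
    have h2 : P ≤ 4 ^ M := by
      refine h1.trans ?_
      rw [← Real.exp_one_pow]
      exact pow_le_pow_left₀ (Real.exp_pos 1).le (by linarith [Real.exp_one_lt_d9]) _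
    calc 2 * P ≤ P * P := by nlinarith
      _ ≤ 4 ^ M * 4 ^ M := mul_le_mul h2 h2 (by linarith) (by positivity)
      _ = 16 ^ M := by rw [← mul_pow]; norm_num
  obtain ⟨q, hdeg, h0, h1, hle, hs⟩ := exists_multiplier_polynomial (m := m) hn
    (by exact_mod_cast (show (n : ℝ) ≤ (m : ℝ) ^ 2 by nlinarith))
    (by exact_mod_cast (show (m : ℝ) ^ 2 ≤ 4 * n by nlinarith)) hPM
  refine ⟨_, soSExact_of_multiplier hn (by linarith) hdeg h0 h1 hle hs, ?_⟩
  push_cast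
  have h3 : ((M : ℝ) + 1) * m ≤ 4 * Real.log P * (2 * Real.sqrt n) :=
    mul_le_mul hM2 hm2 (by positivity) (by linarith)
  nlinarith

/-! ### Symmetrization over slices -/

theorem eval_indicator_monomial {n : ℕ} (S : Finset (Fin n)) (m : Fin n →₀ ℕ) (c : ℝ) :
    MvPolynomial.eval (fun i => if i ∈ S then (1 : ℝ) else 0) (MvPolynomial.monomial m c) =
      if m.support ⊆ S then c else 0 := by
  rw [MvPolynomial.eval_monomial, Finsupp.prod]
  split_ifs with h
  · rw [Finset.prod_eq_one fun i hi => by simp [h hi], mul_one]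
  · obtain ⟨i, hi, hiS⟩ := Finset.not_subset.1 h
    rw [Finset.prod_eq_zero hi, mul_zero]
    simp [hiS, Finsupp.mem_support_iff.1 hi]

/-- The proportion of `k`-sets containing `A` is a ratio of falling factorials, hence a polynomial
in `k` of degree `A.card`. This is what bounds the degree after averaging. -/
theorem card_filter_subset_mul_descFactorial {n k : ℕ} (A : Finset (Fin n)) :
    ((Finset.powersetCard k Finset.univ).filter (A ⊆ ·)).card * n.descFactorial A.card =
      n.choose k * k.descFactorial A.card := by
  have hA : A.card ≤ n := by simpa using A.card_le_univ
  rcases le_or_gt A.card k with h | h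
  · rw [Finset.card_filter_powersetCard_subset _ _ _ (Finset.subset_univ A) h, Finset.card_univ,
      Fintype.card_fin, Nat.descFactorial_eq_factorial_mul_choose,
      Nat.descFactorial_eq_factorial_mul_choose, mul_left_comm, mul_comm _ (n.choose _),
      ← Nat.choose_mul h]
    ring
  · rw [Nat.descFactorial_eq_zero_iff_lt.2 h, mul_zero, Finset.card_eq_zero.2, zero_mul]
    refine Finset.filter_false_of_mem fun S hS hAS => ?_
    have := Finset.card_le_card hAS
    rw [(Finset.mem_powersetCard.1 hS).2] at this
    omega

/-- Averaging a polynomial over the slices of the Boolean cube gives a univariate polynomial of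
no larger degree. -/
theorem exists_symmetrization {n : ℕ} (p : MvPolynomial (Fin n) ℝ) :
    ∃ h : Polynomial ℝ, h.natDegree ≤ p.totalDegree ∧ ∀ k ≤ n,
      ∑ S ∈ Finset.powersetCard k Finset.univ,
        MvPolynomial.eval (fun i => if i ∈ S then (1 : ℝ) else 0) p = n.choose k * h.eval (k : ℝ) := by
  refine ⟨∑ m ∈ p.support, Polynomial.C (p.coeff m / n.descFactorial m.support.card) *
    descPochhammer ℝ m.support.card, ?_, fun k hk => ?_⟩
  · refine Polynomial.natDegree_sum_le_of_forall_le _ _ fun m hm => ?_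
    refine (Polynomial.natDegree_C_mul_le _ _).trans ?_
    rw [descPochhammer_natDegree]
    refine le_trans ?_ (MvPolynomial.le_totalDegree hm)
    rw [Finset.card_eq_sum_ones]
    exact Finset.sum_le_sum fun i hi => Nat.one_le_iff_ne_zero.2 (Finsupp.mem_support_iff.1 hi)
  · have h1 : ∀ S : Finset (Fin n),
        MvPolynomial.eval (fun i => if i ∈ S then (1 : ℝ) else 0) p =
          ∑ m ∈ p.support, if m.support ⊆ S then p.coeff m else 0 := by
      intro S
      conv_lhs => rw [p.as_sum]
      rw [map_sum]
      exact Finset.sum_congr rfl fun m _ => eval_indicator_monomial S m _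
    simp only [h1]
    rw [Finset.sum_comm, Polynomial.eval_finsetSum, Finset.mul_sum]
    refine Finset.sum_congr rfl fun m _ => ?_
    rw [← Finset.sum_filter, Finset.sum_const, nsmul_eq_mul, Polynomial.eval_mul,
      Polynomial.eval_C, descPochhammer_eval_eq_descFactorial]
    have h2 : (n.descFactorial m.support.card : ℝ) ≠ 0 := by
      have hA : m.support.card ≤ n := by simpa using m.support.card_le_univ
      exact_mod_cast (Nat.descFactorial_pos.2 hA).ne'
    have h3 : (((Finset.powersetCard k Finset.univ).filter (m.support ⊆ ·)).card : ℝ) *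
        n.descFactorial m.support.card = n.choose k * k.descFactorial m.support.card := by
      exact_mod_cast card_filter_subset_mul_descFactorial m.support
    field_simp
    linear_combination p.coeff m * h3

/-! ### Lagrange interpolation at quadratically spaced nodes -/

/-- `(m - i)! (m + i)!` in terms of the product of the `|i² - j²|` over `1 ≤ j ≤ m`, `j ≠ i`. -/
theorem prod_abs_sq_sub_sq {m i : ℕ} (hi : 1 ≤ i) (him : i ≤ m) :
    2 * (i : ℝ) ^ 2 * ∏ j ∈ (Finset.Icc 1 m).erase i, |(i : ℝ) ^ 2 - (j : ℝ) ^ 2| =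
      (m - i).factorial * (m + i).factorial := by
  induction m, him using Nat.le_induction with
  | base =>
    -- Partial products of `(i - j)(i + j)` over `j ≤ k`, cleared of denominators; the base case
    -- needs `k = i - 1`.
    have h1 : ∀ k < i, ((i - 1 - k).factorial * i.factorial : ℝ) *
        ∏ j ∈ Finset.Icc 1 k, |(i : ℝ) ^ 2 - (j : ℝ) ^ 2| =
        (i - 1).factorial * (i + k).factorial := by
      intro k hk
      induction k with
      | zero => simp
      | succ k ih =>
        rw [Finset.prod_Icc_succ_top (by omega)]
        have h2 := ih (by omega)
        have h3 : |(i : ℝ) ^ 2 - ((k + 1 : ℕ) : ℝ) ^ 2| =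
            ((i - 1 - k : ℕ) : ℝ) * (i + k + 1 : ℕ) := by
          have : ((i - 1 - k : ℕ) : ℝ) = i - (k + 1 : ℕ) := by
            rw [← Nat.cast_sub hk.le]; congr 1; omega
          rw [this, abs_of_nonneg]
          · push_cast; ring
          · have : ((k + 1 : ℕ) : ℝ) ≤ i := by exact_mod_cast hk.le
            nlinarith [Nat.cast_nonneg (α := ℝ) (k + 1)]
        have h4 : i - 1 - k = (i - 1 - (k + 1)) + 1 := by omega
        have h5 : ((i - 1 - k).factorial : ℝ) =
            ((i - 1 - k : ℕ) : ℝ) * (i - 1 - (k + 1)).factorial := by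
          rw [h4, Nat.factorial_succ, Nat.cast_mul]
        rw [show i + (k + 1) = i + k + 1 by ring, Nat.factorial_succ, Nat.cast_mul, h3]
        rw [h5] at h2
        linear_combination ((i + k + 1 : ℕ) : ℝ) * h2
    obtain ⟨k, rfl⟩ : ∃ k, i = k + 1 := ⟨i - 1, by omega⟩
    have h6 : (Finset.Icc 1 (k + 1)).erase (k + 1) = Finset.Icc 1 k := by
      ext a; simp only [Finset.mem_erase, Finset.mem_Icc]; omega
    have h7 := h1 k (by omega)
    rw [h6]
    rw [show k + 1 + (k + 1) = (k + 1 + k) + 1 by ring, Nat.factorial_succ (k + 1 + k)]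
    simp only [Nat.add_sub_cancel, Nat.sub_self, Nat.factorial_zero, Nat.factorial_succ k,
      Nat.cast_one, one_mul, Nat.cast_mul] at h7 ⊢
    have h8 : (k.factorial : ℝ) ≠ 0 := by positivity
    have h9 : ((k + 1 : ℕ) : ℝ) * ∏ j ∈ Finset.Icc 1 k, |((k + 1 : ℕ) : ℝ) ^ 2 - (j : ℝ) ^ 2| =
        (k + 1 + k).factorial := by
      apply mul_left_cancel₀ h8
      linear_combination h7
    push_cast at h9 ⊢
    linear_combination 2 * ((k : ℝ) + 1) * h9
  | succ m hm ih =>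
    have h1 : (Finset.Icc 1 (m + 1)).erase i = insert (m + 1) ((Finset.Icc 1 m).erase i) := by
      ext; simp; omega
    rw [h1, Finset.prod_insert (by simp)]
    have h3 : |(i : ℝ) ^ 2 - ((m + 1 : ℕ) : ℝ) ^ 2| = ((m + 1 - i : ℕ) : ℝ) * (m + i + 1 : ℕ) := by
      rw [Nat.cast_sub (by omega), abs_sub_comm, abs_of_nonneg]
      · push_cast; ring
      · have : (i : ℝ) ≤ (m + 1 : ℕ) := by exact_mod_cast (by omega : i ≤ m + 1)
        nlinarith [Nat.cast_nonneg (α := ℝ) i]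
    rw [h3, show m + 1 + i = (m + i) + 1 by ring, Nat.factorial_succ (m + i),
      show m + 1 - i = (m - i) + 1 by omega, Nat.factorial_succ]
    rw [Nat.cast_mul, Nat.cast_mul]
    linear_combination ((m - i + 1 : ℕ) : ℝ) * (m + i + 1 : ℕ) * ih

/-- The central binomial coefficient is the largest in row `2 m`. -/
theorem factorial_sq_le {m i : ℕ} (him : i ≤ m) :
    m.factorial ^ 2 ≤ (m - i).factorial * (m + i).factorial := by
  have h1 := Nat.choose_le_centralBinom (m - i) m
  have h2 := Nat.choose_mul_factorial_mul_factorial (show m - i ≤ 2 * m by omega)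
  have h3 := Nat.choose_mul_factorial_mul_factorial (show m ≤ 2 * m by omega)
  rw [show 2 * m - (m - i) = m + i by omega] at h2
  rw [show 2 * m - m = m by omega] at h3
  rw [Nat.centralBinom] at h1
  have h4 : 0 < (2 * m).choose m := Nat.choose_pos (by omega)
  refine Nat.le_of_mul_le_mul_left ?_ h4
  calc (2 * m).choose m * m.factorial ^ 2 = (2 * m).choose (m - i) * ((m - i).factorial *
        (m + i).factorial) := by rw [sq, ← mul_assoc, h3, ← mul_assoc, h2]
    _ ≤ _ := Nat.mul_le_mul_right _ h1

/-- The values at `0` of the Lagrange basis at the nodes `1², …, m²` are bounded by `2`. -/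
theorem prod_sq_div_abs_le_two {m i : ℕ} (hi : 1 ≤ i) (him : i ≤ m) :
    ∏ j ∈ (Finset.Icc 1 m).erase i, (j : ℝ) ^ 2 / |(i : ℝ) ^ 2 - (j : ℝ) ^ 2| ≤ 2 := by
  have h1 := prod_abs_sq_sub_sq hi him
  have h2 : (i : ℝ) ^ 2 * ∏ j ∈ (Finset.Icc 1 m).erase i, (j : ℝ) ^ 2 = (m.factorial : ℝ) ^ 2 := by
    rw [Finset.mul_prod_erase (Finset.Icc 1 m) (fun j : ℕ => (j : ℝ) ^ 2) (by simp; omega),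
      Finset.prod_pow]
    congr 1
    clear h1 him
    induction m with
    | zero => simp
    | succ m ih => rw [Finset.prod_Icc_succ_top (by omega), ih, Nat.factorial_succ]; push_cast; ring
  have h3 : (m.factorial : ℝ) ^ 2 ≤ (m - i).factorial * (m + i).factorial := by
    exact_mod_cast factorial_sq_le him
  have hi0 : (0 : ℝ) < (i : ℝ) ^ 2 := by positivity
  have hpos : 0 < ∏ j ∈ (Finset.Icc 1 m).erase i, |(i : ℝ) ^ 2 - (j : ℝ) ^ 2| := by
    have h4 : (0 : ℝ) < (m - i).factorial * (m + i).factorial := by positivity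
    rw [← h1] at h4
    exact pos_of_mul_pos_right h4 (by positivity)
  rw [Finset.prod_div_distrib, div_le_iff₀ hpos]
  rw [← h1, ← h2] at h3
  refine le_of_mul_le_mul_left ?_ hi0
  linarith

/-- Telescoping: `2 / (4 i² - 1) = 1 / (2 i - 1) - 1 / (2 i + 1)`. -/
theorem sum_two_div_le_one (m : ℕ) :
    ∑ i ∈ Finset.Icc 1 m, 2 / (4 * (i : ℝ) ^ 2 - 1) ≤ 1 := by
  have : ∑ i ∈ Finset.Icc 1 m, 2 / (4 * (i : ℝ) ^ 2 - 1) = 1 - 1 / (2 * (m : ℝ) + 1) := by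
    induction m with
    | zero => simp
    | succ m ih =>
      rw [Finset.sum_Icc_succ_top (by omega), ih]
      have h1 : (2 * (m : ℝ) + 1) ≠ 0 := by positivity
      have h2 : (2 * ((m : ℝ) + 1) + 1) ≠ 0 := by positivity
      have h3 : 4 * ((m : ℝ) + 1) ^ 2 - 1 = (2 * m + 1) * (2 * (m + 1) + 1) := by ring
      push_cast
      rw [h3]
      field_simp
      ring
  rw [this]
  have : (0 : ℝ) ≤ 1 / (2 * (m : ℝ) + 1) := by positivity
  linarith

/-- A polynomial of degree at most `m` that vanishes at `1` and is bounded by `1` in absolute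
value at the points `4, 16, …, 4 m²` is at most `1` at `0`. -/
theorem eval_zero_le_one_of_bounded {m : ℕ} {h : Polynomial ℝ} (hdeg : h.natDegree ≤ m)
    (h1 : h.eval 1 = 0) (hb : ∀ i ∈ Finset.Icc 1 m, |h.eval (4 * (i : ℝ) ^ 2)| ≤ 1) :
    h.eval 0 ≤ 1 := by
  -- Index `0` carries the node `1`, where `h` vanishes. At the evaluation point `0` this node
  -- contributes the factor `1 / (4 i² - 1)` to the `i`-th basis polynomial, which makes the basis
  -- values summable with total at most `1`.
  let v : ℕ → ℝ := fun i => if i = 0 then 1 else 4 * (i : ℝ) ^ 2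
  have hv : ∀ i, 1 ≤ i → v i = 4 * (i : ℝ) ^ 2 := fun i hi => if_neg (by omega)
  have hs : Finset.range (m + 1) = insert 0 (Finset.Icc 1 m) := by ext; simp; omega
  have hmono : StrictMono v := by
    refine strictMono_nat_of_lt_succ fun i => ?_
    rcases Nat.eq_zero_or_pos i with rfl | hi
    · rw [hv 1 le_rfl]; norm_num [v]
    · rw [hv i hi, hv _ (by omega)]
      push_cast
      have : (0 : ℝ) < i := by exact_mod_cast hi
      nlinarith
  have hvs : Set.InjOn v (Finset.range (m + 1)) := hmono.injective.injOn
  have hint : h = Lagrange.interpolate (Finset.range (m + 1)) v fun i => h.eval (v i) :=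
    Lagrange.eq_interpolate hvs (by
      rw [Finset.card_range]
      exact (Polynomial.degree_le_of_natDegree_le hdeg).trans_lt (by exact_mod_cast m.lt_succ_self))
  have hbasis : ∀ i ∈ Finset.Icc 1 m,
      |(Lagrange.basis (Finset.range (m + 1)) v i).eval 0| ≤ 2 / (4 * (i : ℝ) ^ 2 - 1) := by
    intro i hi
    obtain ⟨hi1, him⟩ := Finset.mem_Icc.1 hi
    have hi1' : (1 : ℝ) ≤ (i : ℝ) ^ 2 := one_le_pow₀ (by exact_mod_cast hi1)
    have herase : (Finset.range (m + 1)).erase i = insert 0 ((Finset.Icc 1 m).erase i) := by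
      ext; simp; omega
    rw [Lagrange.basis, Polynomial.eval_prod, Finset.abs_prod, herase,
      Finset.prod_insert (by simp)]
    have hd : ∀ j, |(Lagrange.basisDivisor (v i) (v j)).eval 0| = |v j| / |v i - v j| := by
      intro j
      rw [Lagrange.basisDivisor, Polynomial.eval_mul, Polynomial.eval_C, Polynomial.eval_sub,
        Polynomial.eval_X, Polynomial.eval_C, zero_sub, abs_mul, abs_neg, abs_inv]
      ring
    have h0 : |(Lagrange.basisDivisor (v i) (v 0)).eval 0| = 1 / (4 * (i : ℝ) ^ 2 - 1) := by
      rw [hd, hv i hi1, show v 0 = 1 from rfl, abs_one, abs_of_nonneg (by linarith)]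
    have hj : ∏ j ∈ (Finset.Icc 1 m).erase i, |(Lagrange.basisDivisor (v i) (v j)).eval 0| =
        ∏ j ∈ (Finset.Icc 1 m).erase i, (j : ℝ) ^ 2 / |(i : ℝ) ^ 2 - (j : ℝ) ^ 2| := by
      refine Finset.prod_congr rfl fun j hj => ?_
      have hj1 := (Finset.mem_Icc.1 (Finset.mem_of_mem_erase hj)).1
      rw [hd, hv i hi1, hv j hj1, ← mul_sub, abs_mul, abs_mul, abs_of_pos (by norm_num : (0:ℝ) < 4),
        abs_of_nonneg (sq_nonneg (j : ℝ)), mul_div_mul_left _ _ (by norm_num : (4 : ℝ) ≠ 0)]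
    rw [h0, hj]
    have := mul_le_mul_of_nonneg_left (prod_sq_div_abs_le_two hi1 him)
      (show 0 ≤ 1 / (4 * (i : ℝ) ^ 2 - 1) from div_nonneg zero_le_one (by linarith))
    refine this.trans (le_of_eq ?_)
    ring
  rw [hint, Lagrange.interpolate_apply, Polynomial.eval_finsetSum, hs, Finset.sum_insert (by simp),
    ← hs, show v 0 = 1 from rfl, h1, map_zero, zero_mul, Polynomial.eval_zero, zero_add]
  refine le_trans (Finset.sum_le_sum fun i hi => ?_) (sum_two_div_le_one m)
  rw [Polynomial.eval_mul, Polynomial.eval_C, hv i (Finset.mem_Icc.1 hi).1]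
  refine (le_abs_self _).trans ?_
  rw [abs_mul]
  exact (mul_le_of_le_one_left (abs_nonneg _) (hb i hi)).trans (hbasis i hi)

/-! ### The lower bound and the conclusion -/

/-- Exactness of the SoS program forces degree `Ω(√n)`. -/
theorem sqrt_le_of_soSExact {n d : ℕ} (hn : 1 ≤ n) {P : ℝ} (hP : 2 ≤ P)
    (hd : SoSExact (mkConstraints n P) (mkObjective n) d) : 1 / 4 * Real.sqrt n ≤ d := by
  classical
  by_contra hlt
  -- The averaged multiplier has degree at most `2 * d`, so the largest node needed is `4 (2 d)²`;
  -- it must be a slice index.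
  have hdn : 4 * (2 * d) ^ 2 ≤ n := by
    have h1 : (4 * d : ℝ) ≤ Real.sqrt n := by linarith
    have h2 := Real.sq_sqrt (Nat.cast_nonneg (α := ℝ) n)
    have h3 : (4 * d : ℝ) ^ 2 ≤ n := h2 ▸ pow_le_pow_left₀ (by positivity) h1 2
    have h4 : (4 * d) ^ 2 ≤ n := by exact_mod_cast h3
    calc _ = (4 * d) ^ 2 := by ring
      _ ≤ n := h4
  rw [soSExact_mkConstraints_iff hn (by linarith)] at hd
  obtain ⟨s₀, hs₀, s, hs, heq⟩ := hd
  set g : MvPolynomial (Fin n) ℝ := mkObjective n - MvPolynomial.C (1 / P) with hg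
  have hgm : g ∈ mkConstraints n P := by simp [mkConstraints, hg]
  have hpt : ∀ x : Fin n → ℝ, (∀ i, x i = 0 ∨ x i = 1) → ∑ i, x i - 1 =
      MvPolynomial.eval x s₀ + MvPolynomial.eval x (s g) * (∑ i, x i - 1 / P) := by
    intro x hx
    have h1 := congrArg (MvPolynomial.eval x) heq
    rw [map_add, map_sum, Finset.sum_eq_single_of_mem g hgm, map_mul, map_sub, hg, map_sub,
      MvPolynomial.eval_C, MvPolynomial.eval_C, eval_mkObjective] at h1
    · exact h1
    · intro b hb hbg
      simp only [mkConstraints, booleanAxioms, Finset.mem_union, Finset.mem_image,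
        Finset.mem_univ, true_and, Finset.mem_singleton] at hb
      rcases hb with (⟨i, rfl⟩ | ⟨i, rfl⟩) | hb
      · rcases hx i with h | h <;> simp [h]
      · rcases hx i with h | h <;> simp [h]
      · exact absurd hb hbg
  obtain ⟨h, hdeg, havg⟩ := exists_symmetrization (s g)
  have hdeg' : h.natDegree ≤ 2 * d :=
    hdeg.trans (totalDegree_le_of_mem_sumsOfSquares (hs g hgm))
  have hP0 : 0 < 1 / P := by positivity
  have hP1 : 1 / P ≤ 1 / 2 := one_div_le_one_div_of_le (by norm_num) hP
  -- The left inequality forces the multiplier to be at least `P` for `k = 0`, at most `0` for `k =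
  -- 1`, and at most `(k - 1) / (k - 1/P) ≤ 1` for `k ≥ 1`.
  have hslice : ∀ k : ℕ, ∀ S ∈ Finset.powersetCard k (Finset.univ : Finset (Fin n)),
      (k : ℝ) - 1 - MvPolynomial.eval (fun i => if i ∈ S then (1 : ℝ) else 0) (s g) *
        (k - 1 / P) ≥ 0 ∧
      0 ≤ MvPolynomial.eval (fun i => if i ∈ S then (1 : ℝ) else 0) (s g) := by
    intro k S hS
    have hsum : ∑ i, (if i ∈ S then (1 : ℝ) else 0) = k := by
      simp [(Finset.mem_powersetCard.1 hS).2]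
    have h1 := hpt (fun i => if i ∈ S then (1 : ℝ) else 0)
      (fun i => by by_cases h : i ∈ S <;> simp [h])
    have h2 := eval_nonneg_of_mem_sumsOfSquares hs₀ (fun i => if i ∈ S then (1 : ℝ) else 0)
    rw [hsum] at h1
    exact ⟨by linarith, eval_nonneg_of_mem_sumsOfSquares (hs g hgm) _⟩
  have hle : ∀ k ≤ n, ∀ c : ℝ, (∀ S ∈ Finset.powersetCard k (Finset.univ : Finset (Fin n)),
      MvPolynomial.eval (fun i => if i ∈ S then (1 : ℝ) else 0) (s g) ≤ c) → h.eval (k : ℝ) ≤ c := by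
    intro k hk c hc
    have h1 := Finset.sum_le_card_nsmul _ _ _ hc
    rw [havg k hk, Finset.card_powersetCard, Finset.card_univ, Fintype.card_fin, nsmul_eq_mul] at h1
    exact le_of_mul_le_mul_left h1 (by exact_mod_cast Nat.choose_pos hk)
  have hge : ∀ k ≤ n, ∀ c : ℝ, (∀ S ∈ Finset.powersetCard k (Finset.univ : Finset (Fin n)),
      c ≤ MvPolynomial.eval (fun i => if i ∈ S then (1 : ℝ) else 0) (s g)) → c ≤ h.eval (k : ℝ) := by
    intro k hk c hc
    have h1 := Finset.card_nsmul_le_sum _ _ _ hc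
    rw [havg k hk, Finset.card_powersetCard, Finset.card_univ, Fintype.card_fin, nsmul_eq_mul] at h1
    exact le_of_mul_le_mul_left h1 (by exact_mod_cast Nat.choose_pos hk)
  have hnn : ∀ k ≤ n, 0 ≤ h.eval (k : ℝ) := fun k hk => hge k hk 0 fun S hS => (hslice k S hS).2
  have hh0 : 2 ≤ h.eval 0 := by
    have := hge 0 (Nat.zero_le n) 2 fun S hS => by
      obtain ⟨h1, h2⟩ := hslice 0 S hS
      push_cast at h1
      nlinarith
    simpa using this
  have hh1 : h.eval 1 = 0 := by
    have h2 := hle 1 hn 0 fun S hS => by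
      have h1 := (hslice 1 S hS).1
      push_cast at h1
      nlinarith
    have h3 := hnn 1 hn
    rw [Nat.cast_one] at h2 h3
    exact le_antisymm h2 h3
  have hb : ∀ k ≤ n, 1 ≤ k → |h.eval (k : ℝ)| ≤ 1 := by
    intro k hk hk1
    rw [abs_of_nonneg (hnn k hk)]
    refine hle k hk 1 fun S hS => ?_
    have h1 := (hslice k S hS).1
    have h2 : (1 : ℝ) ≤ k := by exact_mod_cast hk1
    nlinarith
  have := eval_zero_le_one_of_bounded hdeg' hh1 fun i hi => by
    obtain ⟨hi1, hi2⟩ := Finset.mem_Icc.1 hi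
    have := hb (4 * i ^ 2) (le_trans (by gcongr) hdn) (by nlinarith)
    simpa using this
  linarith

theorem theorem2 :
    ∃ c C : ℝ, 0 < c ∧ 0 < C ∧ ∀ n : ℕ, 1 ≤ n → ∀ P : ℝ, 2 ≤ P →
      ∃ r : ℕ, IsSoSRank (mkConstraints n P) (mkObjective n) r ∧
        (r : ℝ) ≤ C * (Real.sqrt n * Real.log P) ∧
        c * Real.sqrt n ≤ (r : ℝ) := by
  classical
  refine ⟨1 / 4, 34, by norm_num, by norm_num, fun n hn P hP => ?_⟩
  obtain ⟨d, hd, hdle⟩ := exists_soSExact_le hn hP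
  have hex : ∃ d, SoSExact (mkConstraints n P) (mkObjective n) d := ⟨d, hd⟩
  refine ⟨Nat.find hex, ⟨Nat.find_spec hex, fun k hk => Nat.find_min' hex hk⟩, ?_,
    sqrt_le_of_soSExact hn hP (Nat.find_spec hex)⟩
  exact le_trans (by exact_mod_cast Nat.find_min' hex hd) hdle
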